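/- **Proposition (necessity of unlabeled data).** There is a universal constant $c>0$ such that the following holds for all integers $d\ge 3$ and $n,N\ge 0$ with $n+N\ge 1$ and $\sqrt{d/(512(n+N))}\le 1/(4e)$, every fixed (known) $\beta\in\mathbb{R}^d$ with $\|\beta\|_2=1$, and every fixed noise level $\sigma\ge 0$. Let $\beta_1=\beta$, $\beta_2=-\beta$, and let $\mathcal{P}$ be the set of all pairs $P=(P^1,P^2)$ of distributions on $\mathbb{R}^d\times\mathbb{R}$ such that, under $P^k$, $X\sim\mathcal{N}(0,\Sigma_k)$ and $Y=\langle X,\beta_k\rangle+\xi$ with $\xi\sim\mathcal{N}(0,\sigma^2)$ independent of $X$, where $\Sigma_1,\Sigma_2$ are (unknown) symmetric matrices with $\tfrac12 I_d\preceq\Sigma_k\preceq\tfrac32 I_d$. For $\lambda=(1/2,1/2)$ let $$\vartheta_\lambda=\vartheta_\lambda(P)=\operatorname*{arg\,min}_{\vartheta\in\mathbb{R}^d}\ \sum_{k=1}^2\tfrac12\,\mathbb{E}_{(X,Y)\sim P^k}\big[(\langle X,\vartheta\rangle-Y)^2\big].$$ For each $k\in\{1,2\}$ we observe $n$ labeled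 i.i.d. samples from $P^k$ and $N$ unlabeled i.i.d. samples from the marginal $P^k_X$, all independent; $\mathcal{D}$ denotes all these data. Then $$\inf_{\widehat\vartheta}\ \sup_{P\in\mathcal{P}}\ \mathbb{E}_{\mathcal{D}}\big[\|\widehat\vartheta(\mathcal{D})-\vartheta_\lambda(P)\|_2\big]\ \ge\ c\,\sqrt{\frac{d}{n+N}},$$ where the infimum is over all estimators, i.e. all measurable maps $\widehat\vartheta$ from the data to $\mathbb{R}^d$ (which may depend on $\beta,\sigma,d,n,N$). -/

import Mathlib

open MeasureTheory ProbabilityTheory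
open scoped NNReal ENNReal

namespace MOL

/-- The law of a labelled pair `(X, Y)` with `Y = ⟪X, β⟫ + ξ`, where `X` has law `μX` and the
noise `ξ ∼ N(0, v)` (`v` is the variance) is independent of `X`. -/
noncomputable def regressionLaw {d : ℕ} (μX : Measure (EuclideanSpace ℝ (Fin d)))
    (β : EuclideanSpace ℝ (Fin d)) (v : ℝ≥0) : Measure (EuclideanSpace ℝ (Fin d) × ℝ) :=
  (μX.prod (gaussianReal 0 v)).map (fun p => (p.1, inner ℝ p.1 β + p.2))

/-- The prediction risk `E_{(X,Y) ∼ P} [(⟪X, ϑ⟫ - Y)²]`. -/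
noncomputable def risk {d : ℕ} (P : Measure (EuclideanSpace ℝ (Fin d) × ℝ))
    (ϑ : EuclideanSpace ℝ (Fin d)) : ℝ :=
  ∫ z, (inner ℝ z.1 ϑ - z.2) ^ 2 ∂P

/-- The linear scalarization `∑ₖ wₖ Lₖ(ϑ)` of the `K` prediction risks with weights `w`. -/
noncomputable def scalarizedRisk {d K : ℕ} (w : Fin K → ℝ)
    (P : Fin K → Measure (EuclideanSpace ℝ (Fin d) × ℝ)) (ϑ : EuclideanSpace ℝ (Fin d)) : ℝ :=
  ∑ k, w k * risk (P k) ϑ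

/-- The set of minimizers over `ℝᵈ` of the scalarized risk. -/
def scalarizedArgmin {d K : ℕ} (w : Fin K → ℝ)
    (P : Fin K → Measure (EuclideanSpace ℝ (Fin d) × ℝ)) : Set (EuclideanSpace ℝ (Fin d)) :=
  {ϑ | ∀ ϑ', scalarizedRisk w P ϑ ≤ scalarizedRisk w P ϑ'}

/-- The data set: for each `k`, `n k` labelled points `(X, Y)` and `N k` unlabelled points `X`. -/
abbrev Data (d : ℕ) {K : ℕ} (n N : Fin K → ℕ) : Type :=
  (k : Fin K) →
    (Fin (n k) → EuclideanSpace ℝ (Fin d) × ℝ) × (Fin (N k) → EuclideanSpace ℝ (Fin d))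

/-- The law of the data: all points are independent, the labelled ones of group `k` have law
`P k`, the unlabelled ones have the marginal law of `X` under `P k`. -/
noncomputable def dataLaw {d K : ℕ} (n N : Fin K → ℕ)
    (P : Fin K → Measure (EuclideanSpace ℝ (Fin d) × ℝ)) : Measure (Data d n N) :=
  Measure.pi fun k =>
    (Measure.pi fun _ : Fin (n k) => P k).prod
      (Measure.pi fun _ : Fin (N k) => (P k).map Prod.fst)

/-- The minimax error over the set of distributions `model` for estimating the minimizer of the scalarized risk
in Euclidean norm: the infimum over all estimators (measurable maps of the data) of the worst-case
expected error. (Where the minimizer is not unique, the worst one counts.) -/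
noncomputable def minimaxError {d K : ℕ} (w : Fin K → ℝ) (n N : Fin K → ℕ)
    (model : Set (Fin K → Measure (EuclideanSpace ℝ (Fin d) × ℝ))) : ℝ≥0∞ :=
  ⨅ est : {f : Data d n N → EuclideanSpace ℝ (Fin d) // Measurable f},
    ⨆ P ∈ model, ⨆ ϑ ∈ scalarizedArgmin w P, ∫⁻ D, ‖est.1 D - ϑ‖ₑ ∂(dataLaw n N P)

/-- The model: pairs of Gaussian linear regressions with the fixed regression vectors `β, -β` and
fixed noise variance `v`, with covariates `N(0, Σ₁)`, `N(0, Σ₂)` for any symmetric matrices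
`Σ₁`, `Σ₂` such that `(1/2) I ⪯ Σₖ ⪯ (3/2) I` in the Loewner order. -/
def oppositeRegressions {d : ℕ} (β : EuclideanSpace ℝ (Fin d)) (v : ℝ≥0) :
    Set (Fin 2 → Measure (EuclideanSpace ℝ (Fin d) × ℝ)) :=
  {P | ∃ S : Fin 2 → Matrix (Fin d) (Fin d) ℝ,
    (∀ k, (S k).IsSymm ∧ (S k - (1 / 2 : ℝ) • (1 : Matrix (Fin d) (Fin d) ℝ)).PosSemidef ∧
      ((3 / 2 : ℝ) • (1 : Matrix (Fin d) (Fin d) ℝ) - S k).PosSemidef) ∧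
    P 0 = regressionLaw (multivariateGaussian 0 (S 0)) β v ∧
    P 1 = regressionLaw (multivariateGaussian 0 (S 1)) (-β) v}

end MOL

namespace MOL

/-! The proof hides a sign vector in the covariances, where labels do not help. Complete `β` to an
orthonormal basis with `b 0 = β`, put `m = d - 1`, and shear the covariates of the two groups in
opposite directions: `X = z₀ b₀ + ∑ⱼ (zⱼ ± rⱼ z₀) bⱼ₊₁` with standard Gaussian `z`, where `r = a ε`
for a sign vector `ε`. Small shears respect the Loewner bounds (`outerSum_shear_loewner`), and the
scalarized risk is minimized at `r / (1 + ‖r‖²)` (`mem_scalarizedArgmin_shearModel`), so estimating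
the minimizer means estimating the signs.

The label `Y = ± z₀ + ξ` does not involve `r`, so a labelled point is no more informative than `z₀`,
the noise and `X`. With everything but the coefficient in direction `j` held fixed, changing `rⱼ`
only shifts those Gaussian coefficients by `± rⱼ z₀`. The two hypotheses `± a` are thus opposite
Gaussian shifts, of mean squared length `2 (n + N) a²`; for `a` of order `(n + N)^(-1/2)` they stay
indistinguishable (`two_point_gaussian`, `two_point_shearModel`). Assouad's averaging
(`assouad_sum`) adds up the `m` coordinate errors, and Cauchy–Schwarz turns the sum into a Euclidean
error of order `√m a`. -/

lemma ofReal_integral_le_lintegral_ofReal {α : Type*} [MeasurableSpace α] {μ : Measure α}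
    {f : α → ℝ} (hf : Integrable f μ) :
    ENNReal.ofReal (∫ x, f x ∂μ) ≤ ∫⁻ x, ENNReal.ofReal (f x) ∂μ := by
  rw [integral_eq_lintegral_pos_part_sub_lintegral_neg_part hf]
  exact (ENNReal.ofReal_le_ofReal (sub_le_self _ ENNReal.toReal_nonneg)).trans
    ENNReal.ofReal_toReal_le

/-! ### Gaussian shifts: densities, moments and the two-point bound. -/

lemma gaussianReal_one_eq_withDensity (h : ℝ) :
    gaussianReal h 1 =
      (gaussianReal 0 1).withDensity (fun x => ENNReal.ofReal (Real.exp (h * x - h ^ 2 / 2))) := by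
  rw [gaussianReal_of_var_ne_zero h one_ne_zero, gaussianReal_of_var_ne_zero 0 one_ne_zero,
    ← withDensity_mul _ (measurable_gaussianPDF 0 1) (by fun_prop)]
  congr 1
  ext x
  simp only [gaussianPDF, Pi.mul_apply, gaussianPDFReal]
  rw [← ENNReal.ofReal_mul (by positivity), mul_assoc (√_)⁻¹, ← Real.exp_add]
  congr 3
  simp
  ring

/-- A product of measures with densities has the product density. -/
lemma pi_withDensity {ι : Type*} [Fintype ι] {α : ι → Type*} [∀ i, MeasurableSpace (α i)]
    (μ : ∀ i, Measure (α i)) [∀ i, IsProbabilityMeasure (μ i)] (f : ∀ i, α i → ℝ≥0∞)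
    (hf : ∀ i, Measurable (f i)) [∀ i, SigmaFinite ((μ i).withDensity (f i))] :
    Measure.pi (fun i => (μ i).withDensity (f i)) =
      (Measure.pi μ).withDensity (fun x => ∏ i, f i (x i)) := by
  refine Measure.pi_eq fun s hs => ?_
  have hind : iIndepFun (fun i (x : ∀ i, α i) => (s i).indicator (f i) (x i)) (Measure.pi μ) :=
    iIndepFun_pi fun i => ((hf i).indicator (hs i)).aemeasurable
  have key := lintegral_prod_eq_prod_lintegral_of_indepFun Finset.univ _ hind
    (fun i => ((hf i).indicator (hs i)).comp (measurable_pi_apply i))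
  rw [withDensity_apply _ (MeasurableSet.univ_pi hs), ← lintegral_indicator (.univ_pi hs)]
  have : (Set.univ.pi s).indicator (fun x => ∏ i, f i (x i)) =
      fun x => ∏ i, (s i).indicator (f i) (x i) := by
    ext x
    by_cases hx : x ∈ Set.univ.pi s
    · rw [Set.indicator_of_mem hx]
      exact Finset.prod_congr rfl fun i _ => (Set.indicator_of_mem (hx i trivial) _).symm
    · rw [Set.indicator_of_notMem hx]
      simp only [Set.mem_pi, Set.mem_univ, true_imp_iff, not_forall] at hx
      obtain ⟨i, hi⟩ := hx
      exact (Finset.prod_eq_zero (Finset.mem_univ i) (Set.indicator_of_notMem hi _)).symm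
  rw [this, key]
  refine Finset.prod_congr rfl fun i _ => ?_
  rw [withDensity_apply _ (hs i), ← lintegral_indicator (hs i)]
  exact (measurePreserving_eval μ i).lintegral_comp ((hf i).indicator (hs i))

/-- Cameron–Martin formula for the standard Gaussian measure on `ι → ℝ`. -/
lemma lintegral_pi_gaussianReal_add {ι : Type*} [Fintype ι] (h : ι → ℝ) {F : (ι → ℝ) → ℝ≥0∞}
    (hF : Measurable F) :
    ∫⁻ x, F (x + h) ∂(Measure.pi fun _ : ι => gaussianReal 0 1) =
      ∫⁻ x, ENNReal.ofReal (Real.exp (∑ i, h i * x i - (∑ i, h i ^ 2) / 2)) * F x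
        ∂(Measure.pi fun _ : ι => gaussianReal 0 1) := by
  have hmap : (Measure.pi fun _ : ι => gaussianReal 0 1).map (fun x => x + h) =
      (Measure.pi fun _ : ι => gaussianReal 0 1).withDensity
        (fun x => ENNReal.ofReal (Real.exp (∑ i, h i * x i - (∑ i, h i ^ 2) / 2))) := by
    have h1 := Measure.pi_map_pi (μ := fun _ : ι => gaussianReal 0 1)
      (f := fun i (x : ℝ) => x + h i)
      (fun i => (measurable_id.add_const (h i)).aemeasurable)
    simp only [gaussianReal_map_add_const, zero_add] at h1
    have h2 : (fun x : ι → ℝ => x + h) = fun x i => x i + h i := rfl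
    have : ∀ i, SigmaFinite ((gaussianReal 0 1).withDensity
        (fun x => ENNReal.ofReal (Real.exp (h i * x - h i ^ 2 / 2)))) := fun i => by
      rw [← gaussianReal_one_eq_withDensity]; infer_instance
    rw [h2, h1]
    simp_rw [gaussianReal_one_eq_withDensity (h _)]
    rw [pi_withDensity _ _ (fun i => by fun_prop)]
    congr 1
    ext x
    rw [← ENNReal.ofReal_prod_of_nonneg (fun _ _ => (Real.exp_pos _).le), ← Real.exp_sum,
      Finset.sum_sub_distrib, Finset.sum_div]
  rw [← lintegral_map (μ := Measure.pi fun _ : ι => gaussianReal 0 1) hF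
    (measurable_add_const h), hmap,
    lintegral_withDensity_eq_lintegral_mul _ (by fun_prop) hF]
  rfl

lemma memLp_sum_mul_pi_gaussianReal {ι : Type*} [Fintype ι] (h : ι → ℝ) :
    MemLp (fun x : ι → ℝ => ∑ i, h i * x i) 2 (Measure.pi fun _ : ι => gaussianReal 0 1) :=
  memLp_finsetSum _ fun i _ =>
    ((memLp_id_gaussianReal 2).comp_measurePreserving
      (measurePreserving_eval (fun _ : ι => gaussianReal 0 1) i)).const_mul (h i)

lemma integral_sum_mul_pi_gaussianReal {ι : Type*} [Fintype ι] (h : ι → ℝ) :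
    ∫ x : ι → ℝ, ∑ i, h i * x i ∂(Measure.pi fun _ : ι => gaussianReal 0 1) = 0 := by
  rw [integral_finsetSum]
  · refine Finset.sum_eq_zero fun i _ => ?_
    rw [integral_const_mul, integral_eval (μ := fun _ : ι => gaussianReal 0 1)]
    simp
  · exact fun i _ => (((memLp_id_gaussianReal 1).comp_measurePreserving
      (measurePreserving_eval (fun _ : ι => gaussianReal 0 1) i)).integrable le_rfl).const_mul (h i)

lemma integral_sq_sum_mul_pi_gaussianReal {ι : Type*} [Fintype ι] (h : ι → ℝ) :
    ∫ x : ι → ℝ, (∑ i, h i * x i) ^ 2 ∂(Measure.pi fun _ : ι => gaussianReal 0 1) =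
      ∑ i, h i ^ 2 := by
  rw [← variance_of_integral_eq_zero (memLp_sum_mul_pi_gaussianReal h).aemeasurable
    (integral_sum_mul_pi_gaussianReal h)]
  have : (fun x : ι → ℝ => ∑ i, h i * x i) = ∑ i, fun x : ι → ℝ => h i * x i := by
    ext x; simp
  rw [this, variance_sum_pi (X := fun i x => h i * x)]
  · refine Finset.sum_congr rfl fun i _ => ?_
    rw [variance_const_mul, variance_fun_id_gaussianReal]
    simp
  · exact fun i => (memLp_id_gaussianReal 2).const_mul _

/-- Two-point lower bound for the Gaussian shift experiment. -/
lemma two_point_gaussian {ι : Type*} [Fintype ι] (h : ι → ℝ) {F G : (ι → ℝ) → ℝ≥0∞}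
    (hF : Measurable F) (hG : Measurable G) {δ : ℝ≥0∞} (hFG : ∀ x, δ ≤ F x + G x) :
    δ * ENNReal.ofReal (3 / 4 - 3 / 2 * ∑ i, h i ^ 2) ≤
      ∫⁻ x, F (x + h) ∂(Measure.pi fun _ : ι => gaussianReal 0 1) +
        ∫⁻ x, G (x - h) ∂(Measure.pi fun _ : ι => gaussianReal 0 1) := by
  set γ := Measure.pi fun _ : ι => gaussianReal 0 1
  set q := ∑ i, h i ^ 2 with hq
  have hint : Integrable (fun x : ι → ℝ => (∑ i, h i * x i) ^ 2) γ :=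
    (memLp_sum_mul_pi_gaussianReal h).integrable_sq
  have hlow : ENNReal.ofReal (3 / 4 - 3 / 2 * q) ≤
      ∫⁻ x : ι → ℝ, ENNReal.ofReal (3 / 4 - q / 2 - (∑ i, h i * x i) ^ 2) ∂γ := by
    refine le_trans (le_of_eq ?_) (ofReal_integral_le_lintegral_ofReal
      (((integrable_const _).sub hint)))
    congr 1
    rw [integral_sub (integrable_const _) hint, integral_const,
      integral_sq_sum_mul_pi_gaussianReal]
    simp
    ring
  -- Both likelihood ratios, relative to the centred Gaussian, are bounded below by one quadratic,
  -- through `exp s ≥ 1 + s` and `1 ± t ≥ 3/4 - t²`. Its integral needs only the second moment `q`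
  -- of `t`.
  have hmin : ∀ x : ι → ℝ, ENNReal.ofReal (3 / 4 - q / 2 - (∑ i, h i * x i) ^ 2) ≤
      min (ENNReal.ofReal (Real.exp (∑ i, h i * x i - q / 2)))
        (ENNReal.ofReal (Real.exp (∑ i, (-h) i * x i - (∑ i, (-h) i ^ 2) / 2))) := by
    intro x
    have e : ∑ i, (-h) i * x i - (∑ i, (-h) i ^ 2) / 2 = -(∑ i, h i * x i) - q / 2 := by
      simp [hq]
    rw [e]
    refine le_min ?_ ?_ <;> refine ENNReal.ofReal_le_ofReal ?_
    · nlinarith [Real.add_one_le_exp (∑ i, h i * x i - q / 2),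
        sq_nonneg (∑ i, h i * x i + 1 / 2)]
    · nlinarith [Real.add_one_le_exp (-(∑ i, h i * x i) - q / 2),
        sq_nonneg (∑ i, h i * x i - 1 / 2)]
  simp_rw [sub_eq_add_neg _ h]
  rw [lintegral_pi_gaussianReal_add h hF, lintegral_pi_gaussianReal_add (-h) hG,
    ← lintegral_add_left (by fun_prop)]
  calc _ ≤ δ * ∫⁻ x : ι → ℝ, ENNReal.ofReal (3 / 4 - q / 2 - (∑ i, h i * x i) ^ 2) ∂γ := by
        gcongr
    _ = ∫⁻ x : ι → ℝ, δ * ENNReal.ofReal (3 / 4 - q / 2 - (∑ i, h i * x i) ^ 2) ∂γ := by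
        rw [lintegral_const_mul _ (by fun_prop)]
    _ ≤ _ := by
        refine lintegral_mono fun x => ?_
        obtain ⟨h1, h2⟩ := le_min_iff.1 (hmin x)
        calc _ ≤ (F x + G x) * ENNReal.ofReal (3 / 4 - q / 2 - (∑ i, h i * x i) ^ 2) := by
              gcongr; exact hFG x
          _ = ENNReal.ofReal (3 / 4 - q / 2 - (∑ i, h i * x i) ^ 2) * F x +
              ENNReal.ofReal (3 / 4 - q / 2 - (∑ i, h i * x i) ^ 2) * G x := by ring
          _ ≤ _ := by gcongr

/-! ### Redrawing one coordinate of a product measure. -/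

lemma measurable_update_prod {ι α : Type*} [DecidableEq ι] [MeasurableSpace α] (j : ι) :
    Measurable (fun p : (ι → α) × α => Function.update p.1 j p.2) := by
  refine measurable_pi_iff.2 fun i => ?_
  by_cases hi : i = j
  · subst hi; simpa using measurable_snd
  · simp only [Function.update_of_ne hi]; fun_prop

/-- Resampling one coordinate of a product of probability measures preserves the product. -/
lemma measurePreserving_update {ι : Type*} [Fintype ι] [DecidableEq ι] {α : Type*}
    [MeasurableSpace α] (μ : ι → Measure α) [∀ i, IsProbabilityMeasure (μ i)] (j : ι) :
    MeasurePreserving (fun p : (ι → α) × α => Function.update p.1 j p.2)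
      ((Measure.pi μ).prod (μ j)) (Measure.pi μ) where
  measurable := measurable_update_prod j
  map_eq := by
    refine (Measure.pi_eq fun s hs => ?_).symm
    rw [Measure.map_apply (measurable_update_prod j) (.univ_pi hs)]
    have : (fun p : (ι → α) × α => Function.update p.1 j p.2) ⁻¹' Set.univ.pi s =
        (Set.univ.pi (Function.update s j Set.univ)) ×ˢ s j := by
      ext p
      simp only [Set.mem_preimage, Set.mem_pi, Set.mem_univ, true_imp_iff, Set.mem_prod]
      constructor
      · intro H
        refine ⟨fun i => ?_, by simpa using H j⟩
        by_cases hi : i = j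
        · subst hi; simp
        · simpa [Function.update_of_ne hi] using H i
      · rintro ⟨H1, H2⟩ i
        by_cases hi : i = j
        · subst hi; simpa using H2
        · simpa [Function.update_of_ne hi] using H1 i
    rw [this, Measure.prod_prod, Measure.pi_pi, ← Finset.mul_prod_erase _ _ (Finset.mem_univ j),
      ← Finset.mul_prod_erase _ (fun i => μ i (s i)) (Finset.mem_univ j)]
    rw [Function.update_self, measure_univ, one_mul, mul_comm]
    congr 1
    refine Finset.prod_congr rfl fun i hi => ?_
    rw [Function.update_of_ne (Finset.ne_of_mem_erase hi)]

/-! ### Gaussian covariates as linear images of standard coefficients; shears. -/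

/-- The matrix `∑ c, w c (w c)ᵀ`. -/
def outerSum {κ ι : Type*} [Fintype κ] (w : κ → EuclideanSpace ℝ ι) : Matrix ι ι ℝ :=
  Matrix.of fun i i' => ∑ c, w c i * w c i'

lemma isSymm_outerSum {κ ι : Type*} [Fintype κ] (w : κ → EuclideanSpace ℝ ι) :
    (outerSum w).IsSymm := by
  ext i i'
  simp [outerSum, mul_comm]

lemma dotProduct_outerSum_mulVec {κ ι : Type*} [Fintype κ] [Fintype ι]
    (w : κ → EuclideanSpace ℝ ι) (u : EuclideanSpace ℝ ι) :
    u.ofLp ⬝ᵥ (outerSum w).mulVec u.ofLp = ∑ c, inner ℝ (w c) u ^ 2 := by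
  simp only [dotProduct, Matrix.mulVec, outerSum, Matrix.of_apply, PiLp.inner_apply,
    RCLike.inner_apply, conj_trivial, sq, Finset.sum_mul, Finset.mul_sum]
  rw [Finset.sum_comm]
  simp_rw [Finset.sum_comm (γ := κ)]
  refine Finset.sum_congr rfl fun c _ => ?_
  refine Finset.sum_congr rfl fun i _ => Finset.sum_congr rfl fun i' _ => ?_
  ring

lemma posSemidef_outerSum {κ ι : Type*} [Fintype κ] [Fintype ι]
    (w : κ → EuclideanSpace ℝ ι) : (outerSum w).PosSemidef := by
  refine Matrix.PosSemidef.of_dotProduct_mulVec_nonneg (isSymm_outerSum w) fun x => ?_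
  have := dotProduct_outerSum_mulVec w (WithLp.toLp 2 x)
  simp only [star_trivial]
  rw [show x ⬝ᵥ (outerSum w).mulVec x = _ from this]
  positivity

/-- A linear combination of fixed vectors with standard Gaussian coefficients is a
multivariate Gaussian. -/
lemma map_sum_smul_pi_gaussianReal {κ ι : Type*} [Fintype κ] [Fintype ι] [DecidableEq ι]
    (w : κ → EuclideanSpace ℝ ι) :
    (Measure.pi fun _ : κ => gaussianReal 0 1).map (fun z => ∑ c, z c • w c) =
      multivariateGaussian 0 (outerSum w) := by
  have hm : Measurable (fun z : κ → ℝ => ∑ c, z c • w c) := by fun_prop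
  have := Measure.isProbabilityMeasure_map
    (μ := Measure.pi fun _ : κ => gaussianReal 0 1) hm.aemeasurable
  apply Measure.ext_of_charFun
  ext t
  rw [charFun_multivariateGaussian (posSemidef_outerSum w), dotProduct_outerSum_mulVec,
    charFun_apply, integral_map hm.aemeasurable
    (Measurable.aestronglyMeasurable (by fun_prop))]
  simp_rw [sum_inner, Complex.ofReal_sum, Finset.sum_mul, Complex.exp_sum,
    integral_fintype_prod_eq_prod
      (f := fun i x => Complex.exp ((inner ℝ (x • w i) t : ℝ) * Complex.I)),
    real_inner_smul_left, mul_comm _ (inner ℝ _ _), Complex.ofReal_mul, ← charFun_apply_real,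
    charFun_gaussianReal, ← Complex.exp_sum]
  congr 1
  simp [Finset.sum_div]

/-- The image of an orthonormal basis under the shear `b 0 ↦ b 0 + ∑ j, r j • b (j + 1)`. -/
noncomputable def shear {m : ℕ} {E : Type*} [NormedAddCommGroup E] [InnerProductSpace ℝ E]
    (b : OrthonormalBasis (Fin (m + 1)) ℝ E) (r : Fin m → ℝ) : Fin (m + 1) → E :=
  Fin.cons (b 0 + ∑ j, r j • b j.succ) (fun j => b j.succ)

lemma sum_sq_inner_shear {m : ℕ} {E : Type*} [NormedAddCommGroup E] [InnerProductSpace ℝ E]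
    (b : OrthonormalBasis (Fin (m + 1)) ℝ E) (r : Fin m → ℝ) (u : E) :
    ∑ c, inner ℝ (shear b r c) u ^ 2 =
      (inner ℝ (b 0) u + ∑ j, r j * inner ℝ (b j.succ) u) ^ 2 +
        ∑ j : Fin m, inner ℝ (b j.succ) u ^ 2 := by
  rw [Fin.sum_univ_succ]
  simp [shear, inner_add_left, sum_inner, real_inner_smul_left]

lemma norm_sq_eq_sum_inner_succ {m : ℕ} {E : Type*} [NormedAddCommGroup E]
    [InnerProductSpace ℝ E] (b : OrthonormalBasis (Fin (m + 1)) ℝ E) (u : E) :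
    ‖u‖ ^ 2 = inner ℝ (b 0) u ^ 2 + ∑ j : Fin m, inner ℝ (b j.succ) u ^ 2 := by
  rw [← b.sum_sq_inner_right u, Fin.sum_univ_succ]

/-- The quadratic form is `(p + s)² + U` against `‖u‖² = p² + U`, with `s² ≤ U / 8` by
Cauchy–Schwarz. Completing squares in `p` leaves `U / 2 - s²` below and `U / 2 - 3 s²` above, both
nonnegative. -/
lemma outerSum_shear_loewner {m : ℕ} (b : OrthonormalBasis (Fin (m + 1)) ℝ
    (EuclideanSpace ℝ (Fin (m + 1)))) (r : Fin m → ℝ) (hr : ∑ j, r j ^ 2 ≤ 1 / 8) :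
    (outerSum (shear b r) - (1 / 2 : ℝ) • (1 : Matrix _ _ ℝ)).PosSemidef ∧
      ((3 / 2 : ℝ) • (1 : Matrix _ _ ℝ) - outerSum (shear b r)).PosSemidef := by
  have hquad : ∀ x : Fin (m + 1) → ℝ,
      1 / 2 * (x ⬝ᵥ x) ≤ x ⬝ᵥ (outerSum (shear b r)).mulVec x ∧
        x ⬝ᵥ (outerSum (shear b r)).mulVec x ≤ 3 / 2 * (x ⬝ᵥ x) := by
    intro x
    have h1 := dotProduct_outerSum_mulVec (shear b r) (WithLp.toLp 2 x)
    have h2 : x ⬝ᵥ x = ‖(WithLp.toLp 2 x : EuclideanSpace ℝ (Fin (m + 1)))‖ ^ 2 := by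
      rw [EuclideanSpace.real_norm_sq_eq]
      simp [dotProduct, sq]
    simp only at h1
    rw [h1, h2, sum_sq_inner_shear, norm_sq_eq_sum_inner_succ b]
    set u : EuclideanSpace ℝ (Fin (m + 1)) := WithLp.toLp 2 x
    have hcs := Finset.sum_mul_sq_le_sq_mul_sq Finset.univ r
      (fun j : Fin m => inner ℝ (b j.succ) u)
    have hU : 0 ≤ ∑ j : Fin m, inner ℝ (b j.succ) u ^ 2 := by positivity
    set s := ∑ j, r j * inner ℝ (b j.succ) u
    set U := ∑ j : Fin m, inner ℝ (b j.succ) u ^ 2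
    set p := inner ℝ (b 0) u
    have h8 : s ^ 2 ≤ 1 / 8 * U := hcs.trans (mul_le_mul_of_nonneg_right hr hU)
    constructor
    · nlinarith [sq_nonneg (p + 2 * s)]
    · nlinarith [sq_nonneg (p - 2 * s)]
  have hS : (outerSum (shear b r)).IsHermitian := (posSemidef_outerSum _).isHermitian
  constructor
  · refine Matrix.PosSemidef.of_dotProduct_mulVec_nonneg
      (hS.sub (by simp [Matrix.IsHermitian])) fun x => ?_
    have := (hquad x).1
    simp only [star_trivial, Matrix.sub_mulVec, Matrix.smul_mulVec, Matrix.one_mulVec,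
      dotProduct_sub, dotProduct_smul, smul_eq_mul]
    linarith
  · refine Matrix.PosSemidef.of_dotProduct_mulVec_nonneg
      (Matrix.IsHermitian.sub (by simp [Matrix.IsHermitian]) hS) fun x => ?_
    have := (hquad x).2
    simp only [star_trivial, Matrix.sub_mulVec, Matrix.smul_mulVec, Matrix.one_mulVec,
      dotProduct_sub, dotProduct_smul, smul_eq_mul]
    linarith

/-! ### Risk of the sheared models and its minimizer. -/

/-- The labelled sample built from Gaussian coefficients `p.1` and the noise `p.2`. -/
noncomputable def labelled {κ : Type*} [Fintype κ] {d : ℕ} (w : κ → EuclideanSpace ℝ (Fin d))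
    (β : EuclideanSpace ℝ (Fin d)) (p : (κ → ℝ) × ℝ) : EuclideanSpace ℝ (Fin d) × ℝ :=
  (∑ c, p.1 c • w c, inner ℝ (∑ c, p.1 c • w c) β + p.2)

@[fun_prop]
lemma measurable_labelled {κ : Type*} [Fintype κ] {d : ℕ} (w : κ → EuclideanSpace ℝ (Fin d))
    (β : EuclideanSpace ℝ (Fin d)) : Measurable (labelled w β) := by
  unfold labelled; fun_prop

lemma regressionLaw_multivariateGaussian {κ : Type*} [Fintype κ] {d : ℕ}
    (w : κ → EuclideanSpace ℝ (Fin d)) (β : EuclideanSpace ℝ (Fin d)) (v : ℝ≥0) :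
    regressionLaw (multivariateGaussian 0 (outerSum w)) β v =
      ((Measure.pi fun _ : κ => gaussianReal 0 1).prod (gaussianReal 0 v)).map
        (labelled w β) := by
  rw [regressionLaw, ← map_sum_smul_pi_gaussianReal, ← Measure.map_id (μ := gaussianReal 0 v),
    Measure.map_prod_map _ _ (by fun_prop) measurable_id, Measure.map_map (by fun_prop)
    (by fun_prop), Measure.map_id]
  rfl

lemma risk_regressionLaw {κ : Type*} [Fintype κ] {d : ℕ}
    (w : κ → EuclideanSpace ℝ (Fin d)) (β ϑ : EuclideanSpace ℝ (Fin d)) (v : ℝ≥0) :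
    risk (regressionLaw (multivariateGaussian 0 (outerSum w)) β v) ϑ =
      ∑ c, inner ℝ (w c) (ϑ - β) ^ 2 + v := by
  set γ := Measure.pi fun _ : κ => gaussianReal 0 1
  set h : κ → ℝ := fun c => inner ℝ (w c) (ϑ - β)
  have hp := memLp_sum_mul_pi_gaussianReal h
  have hid : MemLp (fun x : ℝ => x) 2 (gaussianReal 0 v) := memLp_id_gaussianReal 2
  rw [risk, regressionLaw_multivariateGaussian, integral_map (by fun_prop)
    (Measurable.aestronglyMeasurable (by fun_prop))]
  have hexp : (fun x : (κ → ℝ) × ℝ => (inner ℝ (labelled w β x).1 ϑ - (labelled w β x).2) ^ 2) =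
      fun x => ((∑ c, h c * x.1 c) ^ 2 - 2 * ((∑ c, h c * x.1 c) * x.2)) + x.2 ^ 2 := by
    ext x
    have : ∑ c, h c * x.1 c = inner ℝ (∑ c, x.1 c • w c) ϑ - inner ℝ (∑ c, x.1 c • w c) β := by
      rw [← inner_sub_right, sum_inner]
      exact Finset.sum_congr rfl fun c _ => by rw [real_inner_smul_left, mul_comm]
    rw [this]
    simp only [labelled]
    ring
  have i1 : Integrable (fun x : (κ → ℝ) × ℝ => (∑ c, h c * x.1 c) ^ 2)
      (γ.prod (gaussianReal 0 v)) := hp.integrable_sq.comp_fst _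
  have i2 : Integrable (fun x : (κ → ℝ) × ℝ => 2 * ((∑ c, h c * x.1 c) * x.2))
      (γ.prod (gaussianReal 0 v)) :=
    ((hp.integrable (by norm_num)).mul_prod (hid.integrable (by norm_num))).const_mul 2
  have i3 : Integrable (fun x : (κ → ℝ) × ℝ => x.2 ^ 2)
      (γ.prod (gaussianReal 0 v)) := hid.integrable_sq.comp_snd _
  have hv : ∫ x, x ^ 2 ∂(gaussianReal 0 v) = v := by
    rw [← variance_of_integral_eq_zero aemeasurable_id' integral_id_gaussianReal,
      variance_fun_id_gaussianReal]
  rw [hexp, integral_add (f := fun x : (κ → ℝ) × ℝ =>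
      (∑ c, h c * x.1 c) ^ 2 - 2 * ((∑ c, h c * x.1 c) * x.2)) (i1.sub i2) i3,
    integral_sub i1 i2, integral_const_mul,
    integral_prod_mul (fun z : κ → ℝ => ∑ c, h c * z c) (fun x : ℝ => x),
    integral_fun_fst (fun z : κ → ℝ => (∑ c, h c * z c) ^ 2),
    integral_fun_snd (fun x : ℝ => x ^ 2), integral_sum_mul_pi_gaussianReal,
    integral_sq_sum_mul_pi_gaussianReal, hv]
  simp [h]

/-- The sign distinguishing the two groups. -/
def groupSign (k : Fin 2) : ℝ := if k = 0 then 1 else -1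

/-- The pair of opposite regressions along `b 0` whose covariates are sheared in opposite
directions by `± r`. -/
noncomputable def shearModel {m : ℕ}
    (b : OrthonormalBasis (Fin (m + 1)) ℝ (EuclideanSpace ℝ (Fin (m + 1)))) (r : Fin m → ℝ)
    (v : ℝ≥0) (k : Fin 2) : Measure (EuclideanSpace ℝ (Fin (m + 1)) × ℝ) :=
  regressionLaw (multivariateGaussian 0 (outerSum (shear b fun j => groupSign k * r j)))
    (groupSign k • b 0) v

lemma shearModel_mem {m : ℕ}
    (b : OrthonormalBasis (Fin (m + 1)) ℝ (EuclideanSpace ℝ (Fin (m + 1)))) (r : Fin m → ℝ)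
    (v : ℝ≥0) (hr : ∑ j, r j ^ 2 ≤ 1 / 8) :
    shearModel b r v ∈ oppositeRegressions (b 0) v := by
  refine ⟨fun k => outerSum (shear b fun j => groupSign k * r j), fun k =>
    ⟨isSymm_outerSum _, outerSum_shear_loewner b _ ?_⟩, ?_, ?_⟩
  · refine le_trans (le_of_eq ?_) hr
    refine Finset.sum_congr rfl fun j _ => ?_
    unfold groupSign
    split_ifs <;> ring
  · simp [shearModel, groupSign]
  · simp [shearModel, groupSign]

/-- Averaging over the two signs cancels the cross term between `b 0` and the other directions, but
keeps the term linear in `r`, since both the regression vector and the shear change sign. -/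
lemma scalarizedRisk_shearModel {m : ℕ}
    (b : OrthonormalBasis (Fin (m + 1)) ℝ (EuclideanSpace ℝ (Fin (m + 1)))) (r : Fin m → ℝ)
    (v : ℝ≥0) (ϑ : EuclideanSpace ℝ (Fin (m + 1))) :
    scalarizedRisk (fun _ => 1 / 2) (shearModel b r v) ϑ =
      inner ℝ (b 0) ϑ ^ 2 + (1 - ∑ j, r j * inner ℝ (b j.succ) ϑ) ^ 2 +
        ∑ j : Fin m, inner ℝ (b j.succ) ϑ ^ 2 + v := by
  have h0 : inner ℝ (b 0) (b 0) = (1 : ℝ) := by simp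
  have hj : ∀ j : Fin m, inner ℝ (b j.succ) (b 0) = (0 : ℝ) := fun j => by
    simp [b.inner_eq_ite, Fin.succ_ne_zero]
  have hk : ∀ k, risk (shearModel b r v k) ϑ =
      (inner ℝ (b 0) ϑ - groupSign k + groupSign k * ∑ j, r j * inner ℝ (b j.succ) ϑ) ^ 2 +
        ∑ j : Fin m, inner ℝ (b j.succ) ϑ ^ 2 + v := by
    intro k
    rw [shearModel, risk_regressionLaw, sum_sq_inner_shear]
    simp only [inner_sub_right, inner_smul_right, h0, hj, Finset.mul_sum, mul_zero, sub_zero,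
      mul_one, mul_assoc]
  rw [scalarizedRisk, Fin.sum_univ_two, hk, hk]
  simp only [groupSign]
  norm_num
  ring

lemma mem_scalarizedArgmin_shearModel {m : ℕ}
    (b : OrthonormalBasis (Fin (m + 1)) ℝ (EuclideanSpace ℝ (Fin (m + 1)))) (r : Fin m → ℝ)
    (v : ℝ≥0) :
    (1 + ∑ j, r j ^ 2)⁻¹ • ∑ j, r j • b j.succ ∈
      scalarizedArgmin (fun _ => 1 / 2) (shearModel b r v) := by
  intro ϑ
  rw [scalarizedRisk_shearModel, scalarizedRisk_shearModel]
  have h0 : inner ℝ (b 0) (∑ j, r j • b j.succ) = (0 : ℝ) := by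
    simp [inner_sum, inner_smul_right, b.inner_eq_ite, (Fin.succ_ne_zero _).symm]
  have hj : ∀ i : Fin m, inner ℝ (b i.succ) (∑ j, r j • b j.succ) = r i := fun i => by
    simp [inner_sum, inner_smul_right, b.inner_eq_ite]
  simp only [inner_smul_right, h0, hj]
  set q := ∑ j, r j ^ 2 with hq
  have hq0 : 0 ≤ q := by positivity
  set u : Fin m → ℝ := fun j => inner ℝ (b j.succ) ϑ with hu
  have hcs : (∑ j, r j * u j) ^ 2 ≤ q * ∑ j, u j ^ 2 :=
    Finset.sum_mul_sq_le_sq_mul_sq Finset.univ r u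
  -- With `s = ∑ r u` and `y = 1 - s`, this gives `∑ u² + q y² ≥ 2 s y`. Adding `q ∑ u² ≥ s²` yields
  -- `(1 + q) (y² + ∑ u²) ≥ (y + s)² = 1`, which is `key`.
  have hsq : 0 ≤ ∑ j, u j ^ 2 - 2 * (∑ j, r j * u j) * (1 - ∑ j, r j * u j) +
      q * (1 - ∑ j, r j * u j) ^ 2 := by
    set y := 1 - ∑ j, r j * u j
    have : 0 ≤ ∑ j, (u j - r j * y) ^ 2 := by positivity
    refine this.trans (le_of_eq ?_)
    rw [hq, Finset.mul_sum, Finset.sum_mul, Finset.sum_mul, ← Finset.sum_sub_distrib,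
      ← Finset.sum_add_distrib]
    exact Finset.sum_congr rfl fun j _ => by ring
  have e1 : ∑ j, r j * ((1 + q)⁻¹ * r j) = (1 + q)⁻¹ * q := by
    rw [hq, Finset.mul_sum]; exact Finset.sum_congr rfl fun j _ => by ring
  have e2 : ∑ j, ((1 + q)⁻¹ * r j) ^ 2 = (1 + q)⁻¹ ^ 2 * q := by
    rw [hq, Finset.mul_sum]; exact Finset.sum_congr rfl fun j _ => by ring
  rw [e1, e2]
  have e3 : ((1 + q)⁻¹ * 0) ^ 2 + (1 - (1 + q)⁻¹ * q) ^ 2 + (1 + q)⁻¹ ^ 2 * q = 1 / (1 + q) := by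
    field_simp
    ring
  rw [e3]
  have key : 1 / (1 + q) ≤ (1 - ∑ j, r j * u j) ^ 2 + ∑ j, u j ^ 2 := by
    rw [div_le_iff₀ (by positivity)]
    nlinarith
  nlinarith [sq_nonneg (inner ℝ (b 0) ϑ : ℝ)]

/-! ### The data as a function of independent Gaussian coefficients. -/

/-- The data set, labelled points and unlabelled points, made from one random element per point. -/
def dataMap {W : Type*} {d n N : ℕ} (T : Fin 2 → W → EuclideanSpace ℝ (Fin d) × ℝ)
    (ω : Fin 2 × (Fin n ⊕ Fin N) → W) : Data d (fun _ : Fin 2 => n) (fun _ => N) :=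
  fun k => (fun i => T k (ω (k, .inl i)), fun i => (T k (ω (k, .inr i))).1)

lemma measurable_dataMap {W : Type*} [MeasurableSpace W] {d n N : ℕ}
    {T : Fin 2 → W → EuclideanSpace ℝ (Fin d) × ℝ} (hT : ∀ k, Measurable (T k)) :
    Measurable (dataMap (n := n) (N := N) T) := by
  unfold dataMap
  fun_prop

/-- This puts all models on one probability space with a single flat index, so that parameters enter
only through `T`. An unlabelled point is a labelled one whose label is discarded. -/
lemma dataLaw_map {W : Type*} [MeasurableSpace W] (ν : Measure W) [IsProbabilityMeasure ν]
    {d n N : ℕ} {T : Fin 2 → W → EuclideanSpace ℝ (Fin d) × ℝ} (hT : ∀ k, Measurable (T k)) :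
    dataLaw (fun _ => n) (fun _ => N) (fun k => ν.map (T k)) =
      (Measure.pi fun _ : Fin 2 × (Fin n ⊕ Fin N) => ν).map (dataMap T) := by
  have : ∀ k, IsProbabilityMeasure (ν.map (T k)) := fun k =>
    Measure.isProbabilityMeasure_map (hT k).aemeasurable
  have : ∀ k, IsProbabilityMeasure ((ν.map (T k)).map Prod.fst) := fun k =>
    Measure.isProbabilityMeasure_map measurable_fst.aemeasurable
  have hcurry : MeasurePreserving (MeasurableEquiv.curry (Fin 2) (Fin n ⊕ Fin N) W)
      (Measure.pi fun _ : Fin 2 × (Fin n ⊕ Fin N) => ν)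
      (Measure.pi fun _ : Fin 2 => Measure.pi fun _ : Fin n ⊕ Fin N => ν) := by
    refine ⟨MeasurableEquiv.measurable _, ?_⟩
    have := Measure.infinitePi_map_curry (X := W) (fun (_ : Fin 2) (_ : Fin n ⊕ Fin N) => ν)
    simpa only [Measure.infinitePi_eq_pi] using this
  have hk : ∀ k, MeasurePreserving
      (fun x : Fin n ⊕ Fin N → W => (fun i => T k (x (.inl i)), fun i => (T k (x (.inr i))).1))
      (Measure.pi fun _ : Fin n ⊕ Fin N => ν)
      ((Measure.pi fun _ : Fin n => ν.map (T k)).prod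
        (Measure.pi fun _ : Fin N => (ν.map (T k)).map Prod.fst)) := by
    intro k
    have hTk : MeasurePreserving (T k) ν (ν.map (T k)) := (hT k).measurePreserving ν
    have h1 := measurePreserving_pi (fun _ : Fin n => ν) (fun _ => ν.map (T k)) fun _ => hTk
    have h2 := measurePreserving_pi (fun _ : Fin N => ν) (fun _ => (ν.map (T k)).map Prod.fst)
      fun _ => (measurable_fst.measurePreserving (ν.map (T k))).comp hTk
    exact (h1.prod h2).comp (measurePreserving_sumPiEquivProdPi fun _ : Fin n ⊕ Fin N => ν)
  exact ((measurePreserving_pi _ _ hk).comp hcurry).map_eq.symm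

lemma sum_smul_shear {m : ℕ} {E : Type*} [NormedAddCommGroup E] [InnerProductSpace ℝ E]
    (b : OrthonormalBasis (Fin (m + 1)) ℝ E) (r : Fin m → ℝ) (z : Fin (m + 1) → ℝ) :
    ∑ c, z c • shear b r c = z 0 • b 0 + ∑ j, (z j.succ + r j * z 0) • b j.succ := by
  rw [Fin.sum_univ_succ]
  simp only [shear, Fin.cons_zero, Fin.cons_succ, smul_add, Finset.smul_sum, smul_smul, add_smul,
    Finset.sum_add_distrib, add_assoc]
  congr 1
  rw [add_comm]
  simp_rw [mul_comm (z 0)]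

/-- Changing one shear coefficient amounts to shifting the corresponding Gaussian coefficient. -/
lemma labelled_shear_update {m : ℕ}
    (b : OrthonormalBasis (Fin (m + 1)) ℝ (EuclideanSpace ℝ (Fin (m + 1)))) {r r' : Fin m → ℝ}
    (j : Fin m) (hr : ∀ i, i ≠ j → r' i = r i) (β : EuclideanSpace ℝ (Fin (m + 1)))
    (z : Fin (m + 1) → ℝ) (g ξ : ℝ) :
    labelled (shear b r') β (Function.update z j.succ g, ξ) =
      labelled (shear b r) β (Function.update z j.succ (g + (r' j - r j) * z 0), ξ) := by
  have : ∑ c, Function.update z j.succ g c • shear b r' c =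
      ∑ c, Function.update z j.succ (g + (r' j - r j) * z 0) c • shear b r c := by
    rw [sum_smul_shear, sum_smul_shear]
    have h0 : (0 : Fin (m + 1)) ≠ j.succ := (Fin.succ_ne_zero j).symm
    simp only [Function.update_of_ne h0]
    congr 1
    refine Finset.sum_congr rfl fun i _ => ?_
    by_cases hi : i = j
    · subst hi
      simp only [Function.update_self]
      ring_nf
    · have : i.succ ≠ j.succ := fun h => hi (Fin.succ_injective _ h)
      simp only [Function.update_of_ne this, hr i hi]
  simp only [labelled, this]

/-- Replaces coordinate `j` of the first component of every `ω i` by `g i`. -/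
def resample {ι κ : Type*} [DecidableEq κ] (j : κ) (p : (ι → (κ → ℝ) × ℝ) × (ι → ℝ)) :
    ι → (κ → ℝ) × ℝ :=
  fun i => (Function.update (p.1 i).1 j (p.2 i), (p.1 i).2)

/-- This replaces conditioning on all coefficients except the `j`-th: with `ω` fixed, only the fresh
Gaussians `g` remain random. -/
lemma measurePreserving_resample {ι κ : Type*} [Fintype ι] [Fintype κ] [DecidableEq κ]
    (ρ : Measure ℝ) [IsProbabilityMeasure ρ] (j : κ) :
    MeasurePreserving (resample (ι := ι) j)
      ((Measure.pi fun _ : ι => (Measure.pi fun _ : κ => gaussianReal 0 1).prod ρ).prod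
        (Measure.pi fun _ : ι => gaussianReal 0 1))
      (Measure.pi fun _ : ι => (Measure.pi fun _ : κ => gaussianReal 0 1).prod ρ) := by
  set γ := Measure.pi fun _ : κ => gaussianReal 0 1
  have hswap : MeasurePreserving (fun p : ((κ → ℝ) × ℝ) × ℝ => ((p.1.1, p.2), p.1.2))
      ((γ.prod ρ).prod (gaussianReal 0 1)) ((γ.prod (gaussianReal 0 1)).prod ρ) :=
    (measurePreserving_prodAssoc γ (gaussianReal 0 1) ρ).symm.comp
      (((MeasurePreserving.id γ).prod Measure.measurePreserving_swap).comp
        (measurePreserving_prodAssoc γ ρ (gaussianReal 0 1)))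
  have h1 := ((measurePreserving_update (fun _ : κ => gaussianReal 0 1) j).prod
    (MeasurePreserving.id ρ)).comp hswap
  exact (measurePreserving_pi _ _ fun _ : ι => h1).comp
    (measurePreserving_arrowProdEquivProdArrow _ _ ι (fun _ => γ.prod ρ)
      (fun _ => gaussianReal 0 1)).symm

/-- The map producing a point of group `k` of `shearModel` from its Gaussian coefficients. -/
noncomputable def shearSample {m : ℕ}
    (b : OrthonormalBasis (Fin (m + 1)) ℝ (EuclideanSpace ℝ (Fin (m + 1)))) (r : Fin m → ℝ)
    (k : Fin 2) : (Fin (m + 1) → ℝ) × ℝ → EuclideanSpace ℝ (Fin (m + 1)) × ℝ :=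
  labelled (shear b fun j => groupSign k * r j) (groupSign k • b 0)

lemma measurable_shearSample {m : ℕ}
    (b : OrthonormalBasis (Fin (m + 1)) ℝ (EuclideanSpace ℝ (Fin (m + 1)))) (r : Fin m → ℝ)
    (k : Fin 2) : Measurable (shearSample b r k) :=
  measurable_labelled _ _

lemma dataLaw_shearModel {m : ℕ} (n N : ℕ)
    (b : OrthonormalBasis (Fin (m + 1)) ℝ (EuclideanSpace ℝ (Fin (m + 1)))) (r : Fin m → ℝ)
    (v : ℝ≥0) :
    dataLaw (fun _ => n) (fun _ => N) (shearModel b r v) =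
      (Measure.pi fun _ : Fin 2 × (Fin n ⊕ Fin N) =>
        (Measure.pi fun _ : Fin (m + 1) => gaussianReal 0 1).prod (gaussianReal 0 v)).map
        (dataMap (shearSample b r)) := by
  rw [← dataLaw_map _ (measurable_shearSample b r)]
  congr 1
  ext1 k
  rw [shearModel, regressionLaw_multivariateGaussian]
  rfl

/-- The labels survive the change of parameter because a shift along `j.succ` that compensates the
shear leaves `X` itself unchanged. The shift depends on `ω` only through the coefficients along `b
0`, which are not redrawn. -/
lemma dataMap_shearSample_resample {m n N : ℕ}
    (b : OrthonormalBasis (Fin (m + 1)) ℝ (EuclideanSpace ℝ (Fin (m + 1)))) (r : Fin m → ℝ)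
    (j : Fin m) (a : ℝ) (ω : Fin 2 × (Fin n ⊕ Fin N) → (Fin (m + 1) → ℝ) × ℝ)
    (g : Fin 2 × (Fin n ⊕ Fin N) → ℝ) :
    dataMap (shearSample b (Function.update r j a)) (resample j.succ (ω, g)) =
      dataMap (shearSample b (Function.update r j 0))
        (resample j.succ (ω, g + fun i => groupSign i.1 * a * (ω i).1 0)) := by
  have key : ∀ i, shearSample b (Function.update r j a) i.1 (resample j.succ (ω, g) i) =
      shearSample b (Function.update r j 0) i.1
        (resample j.succ (ω, g + fun i => groupSign i.1 * a * (ω i).1 0) i) := by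
    intro i
    simp only [shearSample, resample]
    rw [labelled_shear_update b (r := fun l => groupSign i.1 * Function.update r j 0 l) j
      (fun l hl => by simp [Function.update_of_ne hl])]
    simp
  ext1 k
  simp only [dataMap]
  exact Prod.ext (funext fun i => key (k, .inl i))
    (funext fun i => congrArg Prod.fst (key (k, .inr i)))

/-- Two-point lower bound for the data when one shear coefficient flips from `a` to `-a`. -/
lemma two_point_shearModel {m n N : ℕ}
    (b : OrthonormalBasis (Fin (m + 1)) ℝ (EuclideanSpace ℝ (Fin (m + 1)))) (r : Fin m → ℝ)
    (v : ℝ≥0) (j : Fin m) (a : ℝ)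
    {F G : Data (m + 1) (fun _ : Fin 2 => n) (fun _ => N) → ℝ≥0∞}
    (hF : Measurable F) (hG : Measurable G) {δ : ℝ≥0∞} (hFG : ∀ D, δ ≤ F D + G D) :
    δ * ENNReal.ofReal (3 / 4 - 3 / 2 * (a ^ 2 * (2 * (n + N)))) ≤
      ∫⁻ D, F D ∂(dataLaw (fun _ => n) (fun _ => N) (shearModel b (Function.update r j a) v)) +
      ∫⁻ D, G D
        ∂(dataLaw (fun _ => n) (fun _ => N) (shearModel b (Function.update r j (-a)) v)) := by
  set γ := Measure.pi fun _ : Fin (m + 1) => gaussianReal 0 1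
  set μ := Measure.pi fun _ : Fin 2 × (Fin n ⊕ Fin N) => γ.prod (gaussianReal 0 v)
  have hres := measurePreserving_resample (ι := Fin 2 × (Fin n ⊕ Fin N)) (gaussianReal 0 v) j.succ
  have hmT : ∀ r, Measurable (dataMap (n := n) (N := N) (shearSample b r)) := fun r =>
    measurable_dataMap (measurable_shearSample b r)
  have hint : ∀ (r : Fin m → ℝ) {H : Data (m + 1) (fun _ : Fin 2 => n) (fun _ => N) → ℝ≥0∞},
      Measurable H → ∫⁻ D, H D ∂(dataLaw (fun _ => n) (fun _ => N) (shearModel b r v)) =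
        ∫⁻ ω, ∫⁻ g, H (dataMap (shearSample b r) (resample j.succ (ω, g)))
          ∂(Measure.pi fun _ => gaussianReal 0 1) ∂μ := by
    intro r H hH
    have hHm := hH.comp (hmT r)
    rw [dataLaw_shearModel, lintegral_map hH (hmT r)]
    exact (hres.lintegral_comp hHm).symm.trans
      (lintegral_prod _ (hHm.comp hres.measurable).aemeasurable)
  rw [hint _ hF, hint _ hG, ← lintegral_add_left]
  swap
  · exact ((hF.comp (hmT _)).comp hres.measurable).lintegral_prod_right'
  set h : (Fin 2 × (Fin n ⊕ Fin N) → (Fin (m + 1) → ℝ) × ℝ) → Fin 2 × (Fin n ⊕ Fin N) → ℝ :=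
    fun ω i => groupSign i.1 * a * (ω i).1 0 with hh
  have hpt : ∀ ω, δ * ENNReal.ofReal (3 / 4 - 3 / 2 * ∑ i, h ω i ^ 2) ≤
      ∫⁻ g, F (dataMap (shearSample b (Function.update r j a)) (resample j.succ (ω, g)))
          ∂(Measure.pi fun _ => gaussianReal 0 1) +
        ∫⁻ g, G (dataMap (shearSample b (Function.update r j (-a))) (resample j.succ (ω, g)))
          ∂(Measure.pi fun _ => gaussianReal 0 1) := by
    intro ω
    have hm : Measurable fun g => dataMap (n := n) (N := N)
        (shearSample b (Function.update r j 0)) (resample j.succ (ω, g)) :=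
      ((hmT _).comp hres.measurable).comp measurable_prodMk_left
    have := two_point_gaussian (h ω) (hF.comp hm) (hG.comp hm) fun _ => hFG _
    refine this.trans (le_of_eq ?_)
    congr 1
    · refine lintegral_congr fun g => ?_
      rw [dataMap_shearSample_resample]
      rfl
    · refine lintegral_congr fun g => ?_
      rw [dataMap_shearSample_resample]
      have : (fun i => groupSign i.1 * -a * (ω i).1 0) = -h ω := by
        ext i; simp [hh]
      rw [this, ← sub_eq_add_neg]
      rfl
  refine le_trans ?_ (lintegral_mono hpt)
  -- It remains to average over `ω`: each of the `2 (n + N)` points contributes a squared shift of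
  -- mean `a²`.
  have hcoord : ∀ i, MeasurePreserving
      (fun ω : Fin 2 × (Fin n ⊕ Fin N) → (Fin (m + 1) → ℝ) × ℝ => (ω i).1 0) μ
      (gaussianReal 0 1) := fun i =>
    ((measurePreserving_eval (fun _ : Fin (m + 1) => gaussianReal 0 1) 0).comp
      measurePreserving_fst).comp (measurePreserving_eval _ i)
  have hsq : ∀ i ω, h ω i ^ 2 = a ^ 2 * (ω i).1 0 ^ 2 := by
    intro i ω
    have : groupSign i.1 ^ 2 = 1 := by unfold groupSign; split_ifs <;> norm_num
    simp only [hh, mul_pow, this, one_mul]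
  have hi : ∀ i, Integrable (fun ω => h ω i ^ 2) μ := by
    intro i
    simp_rw [hsq]
    exact ((hcoord i).integrable_comp_of_integrable
      (g := fun x => x ^ 2) (memLp_id_gaussianReal 2).integrable_sq).const_mul _
  have hI : ∫ ω, (3 / 4 - 3 / 2 * ∑ i, h ω i ^ 2) ∂μ =
      3 / 4 - 3 / 2 * (a ^ 2 * (2 * (n + N))) := by
    rw [integral_sub (integrable_const _) ((integrable_finsetSum _ fun i _ => hi i).const_mul _),
      integral_const_mul, integral_finsetSum _ fun i _ => hi i]
    have hone : ∀ i, ∫ ω, h ω i ^ 2 ∂μ = a ^ 2 := by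
      intro i
      simp_rw [hsq]
      rw [integral_const_mul, ← integral_map (φ := fun ω : Fin 2 × (Fin n ⊕ Fin N) →
        (Fin (m + 1) → ℝ) × ℝ => (ω i).1 0) (f := fun x => x ^ 2)
        (hcoord i).measurable.aemeasurable (by fun_prop), (hcoord i).map_eq,
        ← variance_of_integral_eq_zero aemeasurable_id' integral_id_gaussianReal,
        variance_fun_id_gaussianReal]
      simp
    simp only [hone]
    simp
    ring
  rw [← hI]
  calc _ ≤ δ * ∫⁻ ω, ENNReal.ofReal (3 / 4 - 3 / 2 * ∑ i, h ω i ^ 2) ∂μ := by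
        gcongr
        exact ofReal_integral_le_lintegral_ofReal ((integrable_const _).sub
          ((integrable_finsetSum _ fun i _ => hi i).const_mul _))
    _ ≤ _ := lintegral_const_mul_le _ _

/-! ### Assouad's argument and the minimax bound. -/

/-- The vector with entries `± a` and signs `ε`. -/
def signVec {m : ℕ} (a : ℝ) (ε : Fin m → Bool) (j : Fin m) : ℝ := if ε j then a else -a

lemma signVec_update {m : ℕ} (a : ℝ) (ε : Fin m → Bool) (j : Fin m) (s : Bool) :
    signVec a (Function.update ε j s) =
      Function.update (signVec a ε) j (if s then a else -a) := by
  ext i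
  by_cases hi : i = j
  · subst hi; simp [signVec]
  · simp [signVec, Function.update_of_ne hi]

lemma sum_sq_signVec {m : ℕ} (a : ℝ) (ε : Fin m → Bool) :
    ∑ j, signVec a ε j ^ 2 = m * a ^ 2 := by
  have : ∀ j, signVec a ε j ^ 2 = a ^ 2 := fun j => by
    unfold signVec; split_ifs <;> ring
  simp [this]

/-- Assouad's averaging over the hypercube. -/
lemma assouad_sum {m : ℕ} (A : Fin m → (Fin m → Bool) → ℝ≥0∞) (K B : ℝ≥0∞)
    (hK : ∀ j ε, K ≤ A j (Function.update ε j true) + A j (Function.update ε j false))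
    (hB : ∀ ε, ∑ j, A j ε ≤ B) : m * K ≤ 2 * B := by
  have hcard : (Finset.univ : Finset (Fin m → Bool)).card ≠ 0 := Finset.card_ne_zero.2
    Finset.univ_nonempty
  set C : ℝ≥0∞ := ((Finset.univ : Finset (Fin m → Bool)).card : ℝ≥0∞)
  have hC0 : C ≠ 0 := Nat.cast_ne_zero.2 hcard
  have hCt : C ≠ ∞ := ENNReal.natCast_ne_top _
  have hflip : ∀ j, C * K ≤ 2 * ∑ ε, A j ε := by
    intro j
    -- Flipping bit `j` permutes the cube, so summing the two-point bound over all `ε` counts each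
    -- `A j ε` exactly twice.
    have hinv : Function.Involutive fun ε : Fin m → Bool => Function.update ε j (!ε j) := by
      intro ε; simp
    have e : ∑ ε, A j (Function.update ε j (!ε j)) = ∑ ε, A j ε :=
      Equiv.sum_comp hinv.toPerm (A j)
    calc C * K = ∑ _ε : Fin m → Bool, K := by simp [C]
      _ ≤ ∑ ε, (A j ε + A j (Function.update ε j (!ε j))) := by
          refine Finset.sum_le_sum fun ε _ => (hK j ε).trans (le_of_eq ?_)
          rcases h : ε j
          · conv_rhs => rw [← Function.update_eq_self j ε]
            simp [h, add_comm]
          · conv_rhs => rw [← Function.update_eq_self j ε]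
            simp [h]
      _ = 2 * ∑ ε, A j ε := by rw [Finset.sum_add_distrib, e, two_mul]
  have : C * (m * K) ≤ C * (2 * B) := by
    calc C * (m * K) = ∑ _j : Fin m, C * K := by simp; ring
      _ ≤ ∑ j, 2 * ∑ ε, A j ε := Finset.sum_le_sum fun j _ => hflip j
      _ = 2 * ∑ ε, ∑ j, A j ε := by rw [← Finset.mul_sum, Finset.sum_comm]
      _ ≤ 2 * ∑ _ε : Fin m → Bool, B := by gcongr with ε; exact hB ε
      _ = C * (2 * B) := by simp [C]; ring
  exact (ENNReal.mul_le_mul_iff_right hC0 hCt).1 this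

lemma sum_enorm_inner_succ_le {m : ℕ} {E : Type*} [NormedAddCommGroup E]
    [InnerProductSpace ℝ E] (b : OrthonormalBasis (Fin (m + 1)) ℝ E) (u : E) :
    ∑ j : Fin m, ‖(inner ℝ (b j.succ) u : ℝ)‖ₑ ≤ ENNReal.ofReal √m * ‖u‖ₑ := by
  simp_rw [← ofReal_norm]
  rw [← ENNReal.ofReal_sum_of_nonneg fun _ _ => norm_nonneg _,
    ← ENNReal.ofReal_mul (Real.sqrt_nonneg _)]
  refine ENNReal.ofReal_le_ofReal ?_
  rw [← Real.sqrt_sq (norm_nonneg u), ← Real.sqrt_mul (Nat.cast_nonneg _)]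
  refine Real.le_sqrt_of_sq_le ?_
  have h1 := sq_sum_le_card_mul_sum_sq (s := Finset.univ)
    (f := fun j : Fin m => ‖(inner ℝ (b j.succ) u : ℝ)‖)
  simp only [Real.norm_eq_abs, sq_abs, Finset.card_univ, Fintype.card_fin] at h1 ⊢
  refine h1.trans ?_
  rw [norm_sq_eq_sum_inner_succ b]
  gcongr
  nlinarith [sq_nonneg (inner ℝ (b 0) u : ℝ)]

/-- Lower bound on the worst-case error of an arbitrary estimator over the sheared models. -/
lemma ofReal_le_two_mul_sqrt_mul_of_forall_shearModel {m n N : ℕ}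
    (b : OrthonormalBasis (Fin (m + 1)) ℝ (EuclideanSpace ℝ (Fin (m + 1)))) (v : ℝ≥0)
    {a : ℝ} (ha : 0 ≤ a) (ha2 : a ^ 2 * (2 * (n + N)) ≤ 1 / 6)
    {f : Data (m + 1) (fun _ : Fin 2 => n) (fun _ => N) → EuclideanSpace ℝ (Fin (m + 1))}
    (hf : Measurable f) {R : ℝ≥0∞}
    (hR : ∀ ε : Fin m → Bool,
      ∫⁻ D, ‖f D - (1 + m * a ^ 2)⁻¹ • ∑ j, signVec a ε j • b j.succ‖ₑ
        ∂(dataLaw (fun _ => n) (fun _ => N) (shearModel b (signVec a ε) v)) ≤ R) :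
    ENNReal.ofReal (m * ((1 + m * a ^ 2)⁻¹ * a)) ≤ 2 * (ENNReal.ofReal √m * R) := by
  set α : ℝ := (1 + m * a ^ 2)⁻¹ with hα
  have hα0 : 0 ≤ α := by positivity
  have hmeas : ∀ (j : Fin m) (t : ℝ),
      Measurable fun D => ‖(inner ℝ (b j.succ) (f D) - t : ℝ)‖ₑ := fun j t => by fun_prop
  set A : Fin m → (Fin m → Bool) → ℝ≥0∞ := fun j ε =>
    ∫⁻ D, ‖(inner ℝ (b j.succ) (f D) - α * signVec a ε j : ℝ)‖ₑ
      ∂(dataLaw (fun _ => n) (fun _ => N) (shearModel b (signVec a ε) v)) with hA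
  rw [ENNReal.ofReal_mul (Nat.cast_nonneg _), ENNReal.ofReal_natCast]
  refine assouad_sum A _ _ (fun j ε => ?_) (fun ε => ?_)
  · have key := two_point_shearModel (n := n) (N := N) b (signVec a ε) v j a
      (hmeas j (α * a)) (hmeas j (α * -a)) (δ := ENNReal.ofReal (2 * (α * a))) (fun D => by
        rw [← ofReal_norm, ← ofReal_norm,
          ← ENNReal.ofReal_add (norm_nonneg _) (norm_nonneg _)]
        refine ENNReal.ofReal_le_ofReal ?_
        rw [add_comm]
        refine le_trans ?_ (norm_sub_le _ _)
        refine le_trans (le_of_eq ?_) (le_abs_self _)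
        ring)
    simp only [hA, signVec_update, Function.update_self, if_true, Bool.false_eq_true, if_false]
    refine le_trans ?_ key
    rw [← ENNReal.ofReal_mul (by positivity)]
    refine ENNReal.ofReal_le_ofReal ?_
    -- By `ha2` the two-point factor is at least `3/4 - 1/4 = 1/2`, half of the separation `2 α a`.
    nlinarith [mul_nonneg hα0 ha]
  · rw [← lintegral_finsetSum _ fun j _ => hmeas j _]
    calc _ ≤ ∫⁻ D, ENNReal.ofReal √m * ‖f D - α • ∑ j, signVec a ε j • b j.succ‖ₑ
          ∂(dataLaw (fun _ => n) (fun _ => N) (shearModel b (signVec a ε) v)) := by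
          refine lintegral_mono fun D => ?_
          refine le_trans (le_of_eq ?_) (sum_enorm_inner_succ_le b _)
          refine Finset.sum_congr rfl fun j _ => ?_
          congr 1
          simp [inner_sub_right, inner_smul_right, inner_sum, b.inner_eq_ite]
      _ = ENNReal.ofReal √m * ∫⁻ D, ‖f D - α • ∑ j, signVec a ε j • b j.succ‖ₑ
          ∂(dataLaw (fun _ => n) (fun _ => N) (shearModel b (signVec a ε) v)) := by
          rw [lintegral_const_mul' _ _ ENNReal.ofReal_ne_top]
      _ ≤ _ := by gcongr; exact hR ε

lemma ofReal_le_minimaxError {m n N : ℕ}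
    (b : OrthonormalBasis (Fin (m + 1)) ℝ (EuclideanSpace ℝ (Fin (m + 1)))) (v : ℝ≥0)
    (hm : 0 < m) {a : ℝ} (ha : 0 ≤ a) (ha2 : a ^ 2 * (2 * (n + N)) ≤ 1 / 6)
    (hma : m * a ^ 2 ≤ 1 / 8) :
    ENNReal.ofReal (√m * a / 4) ≤
      minimaxError (fun _ : Fin 2 => (1 / 2 : ℝ)) (fun _ => n) (fun _ => N)
        (oppositeRegressions (b 0) v) := by
  refine le_iInf fun ⟨f, hf⟩ => ?_
  set R := ⨆ P ∈ oppositeRegressions (b 0) v,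
    ⨆ ϑ ∈ scalarizedArgmin (fun _ : Fin 2 => (1 / 2 : ℝ)) P,
      ∫⁻ D, ‖f D - ϑ‖ₑ ∂(dataLaw (fun _ => n) (fun _ => N) P)
  have hmain := ofReal_le_two_mul_sqrt_mul_of_forall_shearModel b v ha ha2 hf (R := R) fun ε => by
    have hmem := shearModel_mem b (signVec a ε) v (by rwa [sum_sq_signVec])
    have harg := mem_scalarizedArgmin_shearModel b (signVec a ε) v
    rw [sum_sq_signVec] at harg
    exact le_iSup₂_of_le _ hmem (le_iSup₂_of_le _ harg le_rfl)
  have hs : 0 < √(m : ℝ) := Real.sqrt_pos.2 (Nat.cast_pos.2 hm)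
  have hα : 1 / 2 ≤ (1 + m * a ^ 2)⁻¹ := by
    rw [one_div]
    exact inv_anti₀ (by positivity) (by linarith)
  have h2 : ENNReal.ofReal (2 * √m) * ENNReal.ofReal (√m * a / 4) ≤
      ENNReal.ofReal (2 * √m) * R := by
    rw [← ENNReal.ofReal_mul (by positivity)]
    refine le_trans (ENNReal.ofReal_le_ofReal ?_) (hmain.trans (le_of_eq ?_))
    · have e : 2 * √(m : ℝ) * (√m * a / 4) = m * (1 / 2 * a) := by
        rw [show 2 * √(m : ℝ) * (√m * a / 4) = (√m * √m) * (1 / 2 * a) by ring,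
          Real.mul_self_sqrt (Nat.cast_nonneg _)]
      rw [e]
      gcongr
    · rw [ENNReal.ofReal_mul zero_le_two, ENNReal.ofReal_ofNat, mul_assoc]
  exact (ENNReal.mul_le_mul_iff_right (ENNReal.ofReal_pos.2 (by positivity)).ne'
    ENNReal.ofReal_ne_top).1 h2

lemma exists_orthonormalBasis_zero_eq {m : ℕ} (β : EuclideanSpace ℝ (Fin (m + 1)))
    (hβ : ‖β‖ = 1) :
    ∃ b : OrthonormalBasis (Fin (m + 1)) ℝ (EuclideanSpace ℝ (Fin (m + 1))), b 0 = β := by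
  have hv : Orthonormal ℝ (({0} : Set (Fin (m + 1))).domRestrict fun _ => β) :=
    ⟨fun _ => hβ, fun i j hij => (hij (Subsingleton.elim i j)).elim⟩
  obtain ⟨b, hb⟩ := hv.exists_orthonormalBasis_extension_of_card_eq (by simp)
  exact ⟨b, hb 0 rfl⟩

end MOL

theorem mainTheorem5 :
    ∃ c : ℝ, 0 < c ∧
      ∀ (d n N : ℕ) (β : EuclideanSpace ℝ (Fin d)) (σ : NNReal),
        3 ≤ d → 0 < n + N →
        Real.sqrt ((d : ℝ) / (512 * ((n : ℝ) + (N : ℝ)))) ≤ 1 / (4 * Real.exp 1) →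
        ‖β‖ = 1 →
        ENNReal.ofReal (c * Real.sqrt ((d : ℝ) / ((n : ℝ) + (N : ℝ)))) ≤
          MOL.minimaxError (fun _ : Fin 2 => (1 / 2 : ℝ)) (fun _ => n) (fun _ => N)
            (MOL.oppositeRegressions β (σ ^ 2)) := by
  -- The bound `√m a / 4` with `a = 1 / (8 √M)` is `√m / (32 √M)`; the last factor `2` pays for `√(m
  -- + 1) ≤ 2 √m`.
  refine ⟨1 / 64, by norm_num, fun d n N β σ hd hnN hsmall hβ => ?_⟩
  obtain ⟨m, rfl⟩ : ∃ m, d = m + 1 := ⟨d - 1, by omega⟩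
  obtain ⟨b, rfl⟩ := MOL.exists_orthonormalBasis_zero_eq β hβ
  have hM : (0 : ℝ) < n + N := by exact_mod_cast hnN
  set M : ℝ := n + N with hMdef
  have hm : (1 : ℝ) ≤ m := by exact_mod_cast (by omega : 1 ≤ m)
  have hd8 : (m : ℝ) ≤ 8 * M := by
    have he : (2 : ℝ) ≤ Real.exp 1 := by linarith [Real.add_one_le_exp (1 : ℝ)]
    have h1 : √(((m + 1 : ℕ) : ℝ) / (512 * M)) ≤ 1 / 8 :=
      hsmall.trans (one_div_le_one_div_of_le (by norm_num) (by linarith))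
    rw [Real.sqrt_le_left (by norm_num), div_le_iff₀ (by positivity)] at h1
    push_cast at h1
    linarith
  -- This amplitude meets both constraints: `a² · 2M = 1/32 ≤ 1/6`, and `m a² ≤ 1/8` is exactly `m ≤
  -- 8 M`.
  have ha2 : (1 / (8 * √M)) ^ 2 = 1 / (64 * M) := by
    rw [div_pow, mul_pow, Real.sq_sqrt hM.le]
    norm_num
  refine le_trans (ENNReal.ofReal_le_ofReal ?_) (MOL.ofReal_le_minimaxError b (σ ^ 2)
    (by omega) (a := 1 / (8 * √M)) (by positivity) ?_ ?_)
  · have h1 : √(((m + 1 : ℕ) : ℝ) / M) ≤ 2 * (√m / √M) := by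
      rw [← Real.sqrt_div (Nat.cast_nonneg _)]
      refine Real.sqrt_le_iff.2 ⟨by positivity, ?_⟩
      rw [mul_pow, Real.sq_sqrt (by positivity)]
      push_cast
      rw [mul_div_assoc']
      gcongr
      linarith
    calc 1 / 64 * √(((m + 1 : ℕ) : ℝ) / M) ≤ 1 / 64 * (2 * (√m / √M)) := by gcongr
      _ = √m * (1 / (8 * √M)) / 4 := by
        field_simp
        norm_num
  · rw [ha2, ← hMdef]
    field_simp
    norm_num
  · rw [ha2, mul_one_div, div_le_iff₀ (by positivity)]
    linarith
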